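/- Let $\hbar\in\mathbb C$, $\hbar\neq 0$, and $h=2i\hbar$. Let $U(su(2)_h)$ be the enveloping algebra over $\mathbb C$ with generators $x_1=x$, $x_2=y$, $x_3=z$ and relations $[x,y]=hz$, $[y,z]=hx$, $[z,x]=hy$, and let $$\hat A_h=\bigl(U(su(2)_h)\otimes\mathbb C(\tau,\rho)\bigr)/\langle x^2+y^2+z^2+\hbar^2-\rho^2\rangle ,$$ where $\rho$ is the quantum radius ($\rho_h$) and $\tau=-it$ is the renormalized time. The quantum partial derivatives $\partial_t,\partial_1=\partial_x,\partial_2=\partial_y,\partial_3=\partial_z$ on $\hat A_h$ are defined by the quantum Leibniz rule $\Theta(ab)=\Theta(a)\Theta(b)$, where $$\Theta(a)=i\hbar\begin{pmatrix}\hat\partial_t a&\partial_x a&\partial_y a&\partial_z a\\-\partial_x a&\hat\partial_t a&-\partial_z a&\partial_y a\\-\partial_y a&\partial_z a&\hat\partial_t a&-\partial_x a\\-\partial_z a&-\partial_y a&\partial_x a&\hat\partial_t a\end{pmatrix},\qquad \hat\partial_t=\partial_t+\tfrac{2}{h}\,\mathrm{id},$$ ($\Theta$ being a homomorphism of unital $\mathbb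 C$-algebras), together with their values on generators: $\partial_j x_k=\delta_{jk}$, $\partial_t x_k=0$, $\partial_t t=1$, $\partial_k t=0$, $\partial_t\rho=-i\hbar/\rho$, $\partial_k\rho=x_k/\rho$. Put $\partial_\tau=i\partial_t$. For $f\in\mathbb C(\tau,\rho)$ put $$\partial_\rho f=\frac{f(\tau+\hbar,\rho+\hbar)-f(\tau+\hbar,\rho-\hbar)}{2\hbar}.$$ Then the following hold. 1. For every $f\in\mathbb C(\tau,\rho)$, in $\hat A_h$: $\partial_k f=\frac{x_k}{\rho}\,\partial_\rho f$ for $k=1,2,3$, and $$\partial_\tau f=\frac{f(\tau+\hbar,\rho+\hbar)(\rho+\hbar)+f(\tau+\hbar,\rho-\hbar)(\rho-\hbar)-2\rho f}{2\rho\hbar}\in\mathbb C(\tau,\rho).$$ 2. Write $\underline{ab}=\frac12(ab+ba)$. For complex numbers $c_{kl}^{\,i}=-c_{lk}^{\,i}$ ($1\le i,k,l\le n$) and arbitrary (in general non-commuting) $A_\mu^{\,i}\in\hat A_h$ ($\mu=1,2,3$), the field strength $F_{\mu\nu}^{\,i}=\partial_\mu A_\nu^{\,i}-\partial_\nu A_\mu^{\,i}+\sum_{k,l}c_{kl}^{\,i}\,\underline{A_\mu^{\,k}A_\nu^{\,l}}$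 satisfies $F_{\nu\mu}^{\,i}=-F_{\mu\nu}^{\,i}$. 3. Take $n=3$ and $c_{kl}^{\,i}=\varepsilon_{kli}$ (the Levi-Civita symbol, $\varepsilon_{123}=1$), and for $\varphi^1,\varphi^2,\varphi^3\in\hat A_h$ put $\nabla_\mu\varphi^i=\partial_\mu\varphi^i+\sum_{k,l}\varepsilon_{kli}\,\underline{A_\mu^{\,k}\varphi^l}$. Let $W,F\in\mathbb C(\tau,\rho)$ (in particular, $W$ and $F$ may be rational functions of the quantum radius $\rho$ alone), and substitute the hedgehog ansatz $$A_\mu^{\,i}=\sum_j\varepsilon_{\mu ij}\,x_j\,W,\qquad \varphi^i=x_i\,F .$$ Then the noncommutative Bogomol'nyi equation $F_{\mu\nu}^{\,i}=\sum_\lambda\varepsilon_{\mu\nu\lambda}\nabla_\lambda\varphi^i$ (for all $\mu,\nu,i$) holds in $\hat A_h$ if and only if $W$ and $F$ satisfy in $\mathbb C(\tau,\rho)$ the two scalar equations $$-\frac1\rho\,\partial_\rho W+W^2=\frac1\rho\,\partial_\rho F-FW,$$ $$\frac{\rho^2-\hbar^2}{\rho}\,\partial_\rho W+2W+2\hbar\,\partial_\tau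 W=F+\hbar\,\partial_\tau F+(\rho^2-\hbar^2)\,FW .$$ Moreover, its two components $(\mu,\nu,i)=(1,2,1)$ and $(1,2,3)$ alone are already equivalent to this system. -/

import Mathlib

open scoped TensorProduct Matrix

noncomputable section

namespace NCYM

attribute [local instance 100] LieRing.ofAssociativeRing

/-! ### The algebra of functions in the central variables `τ`, `ρ` -/

/-- The field `ℂ(τ, ρ)` of rational functions in the renormalized time `τ = -i t` and the
quantum radius `ρ`. -/
abbrev CTR : Type := FractionRing (MvPolynomial (Fin 2) ℂ)

/-- The variable `τ` of `ℂ(τ, ρ)`. -/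
def tauV : CTR := algebraMap (MvPolynomial (Fin 2) ℂ) CTR (MvPolynomial.X 0)

/-- The variable `ρ` of `ℂ(τ, ρ)`. -/
def rhoV : CTR := algebraMap (MvPolynomial (Fin 2) ℂ) CTR (MvPolynomial.X 1)

/-- The translation `p(τ, ρ) ↦ p(τ + a, ρ + b)` of polynomials. -/
def polyShift (a b : ℂ) : MvPolynomial (Fin 2) ℂ →ₐ[ℂ] MvPolynomial (Fin 2) ℂ :=
  MvPolynomial.aeval ![MvPolynomial.X 0 + MvPolynomial.C a, MvPolynomial.X 1 + MvPolynomial.C b]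

theorem polyShift_injective (a b : ℂ) : Function.Injective (polyShift a b) := by
  have h : (polyShift (-a) (-b)).comp (polyShift a b) = AlgHom.id ℂ _ := by
    apply MvPolynomial.algHom_ext
    intro i
    fin_cases i <;> simp [polyShift]
  intro p q hpq
  have := congrArg (polyShift (-a) (-b)) hpq
  simpa only [← AlgHom.comp_apply, h, AlgHom.id_apply] using this

theorem polyShiftK_injective (a b : ℂ) : Function.Injective
    ((IsScalarTower.toAlgHom ℂ (MvPolynomial (Fin 2) ℂ) CTR).comp (polyShift a b)) :=
  (IsFractionRing.injective (MvPolynomial (Fin 2) ℂ) CTR).comp (polyShift_injective a b)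

/-- The translation `f(τ, ρ) ↦ f(τ + a, ρ + b)` of rational functions. -/
def shift (a b : ℂ) : CTR →ₐ[ℂ] CTR := IsFractionRing.liftAlgHom (polyShiftK_injective a b)

/-- The quantum radial derivative
`∂_ρ f = (f(τ + ħ, ρ + ħ) - f(τ + ħ, ρ - ħ)) / (2ħ)`. -/
def radialDeriv (hb : ℂ) (f : CTR) : CTR :=
  (shift hb hb f - shift hb (-hb) f) / algebraMap ℂ CTR (2 * hb)

/-- The difference operator
`∂_τ f = (f(τ+ħ, ρ+ħ) (ρ+ħ) + f(τ+ħ, ρ-ħ) (ρ-ħ) - 2 ρ f(τ, ρ)) / (2ρħ)`. -/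
def tauDeriv (hb : ℂ) (f : CTR) : CTR :=
  (shift hb hb f * (rhoV + algebraMap ℂ CTR hb) + shift hb (-hb) f * (rhoV - algebraMap ℂ CTR hb)
    - 2 * rhoV * f) / (2 * rhoV * algebraMap ℂ CTR hb)

/-! ### The noncommutative configuration space -/

/-- The Lie algebra `su(2)_h` (complexified), `h = 2iħ`: its basis `x, y, z` satisfies
`[x, y] = h z`, `[y, z] = h x`, `[z, x] = h y`. -/
def Su2 (_hb : ℂ) : Type := Fin 3 → ℂ

instance (hb : ℂ) : AddCommGroup (Su2 hb) := inferInstanceAs (AddCommGroup (Fin 3 → ℂ))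
instance (hb : ℂ) : Module ℂ (Su2 hb) := inferInstanceAs (Module ℂ (Fin 3 → ℂ))

/-- The bracket `[v, w] = h (v × w)`. -/
def su2Bracket (hb : ℂ) (v w : Fin 3 → ℂ) : Fin 3 → ℂ :=
  (2 * Complex.I * hb) • crossProduct v w

theorem su2Bracket_leibniz (hb : ℂ) (u v w : Fin 3 → ℂ) :
    su2Bracket hb u (su2Bracket hb v w)
      = su2Bracket hb (su2Bracket hb u v) w + su2Bracket hb v (su2Bracket hb u w) := by
  simp only [su2Bracket, map_smul, LinearMap.smul_apply]
  rw [leibniz_cross, smul_add, smul_add]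

instance (hb : ℂ) : LieRing (Su2 hb) where
  bracket v w := su2Bracket hb v w
  add_lie (u v w : Fin 3 → ℂ) :=
    (by simp [su2Bracket] : su2Bracket hb (u + v) w = su2Bracket hb u w + su2Bracket hb v w)
  lie_add (u v w : Fin 3 → ℂ) :=
    (by simp [su2Bracket] : su2Bracket hb u (v + w) = su2Bracket hb u v + su2Bracket hb u w)
  lie_self (v : Fin 3 → ℂ) := (by simp [su2Bracket] : su2Bracket hb v v = 0)
  leibniz_lie u v w := su2Bracket_leibniz hb u v w

instance (hb : ℂ) : LieAlgebra ℂ (Su2 hb) where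
  lie_smul c (v w : Fin 3 → ℂ) :=
    (by simp only [su2Bracket, map_smul]; rw [smul_comm] :
      su2Bracket hb v (c • w) = c • su2Bracket hb v w)

/-- The enveloping algebra `U(su(2)_h)`. -/
abbrev USu2 (hb : ℂ) : Type := UniversalEnvelopingAlgebra ℂ (Su2 hb)

/-- The basis elements `x, y, z` of `su(2)_h`. -/
def su2Gen (hb : ℂ) (k : Fin 3) : Su2 hb := (Pi.single k 1 : Fin 3 → ℂ)

/-- The Casimir element `x² + y² + z²` of `U(su(2)_h)`. -/
def casimir (hb : ℂ) : USu2 hb := ∑ k, UniversalEnvelopingAlgebra.ι ℂ (su2Gen hb k) ^ 2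

/-- The relation `x² + y² + z² + ħ² = ρ²` in `U(su(2)_h) ⊗ ℂ(τ, ρ)`. -/
inductive RadiusRel (hb : ℂ) : USu2 hb ⊗[ℂ] CTR → USu2 hb ⊗[ℂ] CTR → Prop
  | radius : RadiusRel hb (casimir hb ⊗ₜ[ℂ] 1 + algebraMap ℂ (USu2 hb ⊗[ℂ] CTR) (hb ^ 2))
      (1 ⊗ₜ[ℂ] (rhoV ^ 2))

/-- The algebra `Â_h = (U(su(2)_h) ⊗ ℂ(τ, ρ)) / ⟨x² + y² + z² + ħ² - ρ²⟩`. -/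
def Ahat (hb : ℂ) : Type := RingQuot (RadiusRel hb)

instance (hb : ℂ) : Ring (Ahat hb) := inferInstanceAs (Ring (RingQuot (RadiusRel hb)))
instance (hb : ℂ) : Algebra ℂ (Ahat hb) := inferInstanceAs (Algebra ℂ (RingQuot (RadiusRel hb)))

/-- The projection of `U(su(2)_h) ⊗ ℂ(τ, ρ)` onto `Â_h`. -/
def proj (hb : ℂ) : USu2 hb ⊗[ℂ] CTR →ₐ[ℂ] Ahat hb := RingQuot.mkAlgHom ℂ (RadiusRel hb)

/-- The map `U(su(2)_h) → Â_h`. -/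
def ofU (hb : ℂ) : USu2 hb →ₐ[ℂ] Ahat hb := (proj hb).comp Algebra.TensorProduct.includeLeft

/-- A function `f(τ, ρ)`, regarded as a (central) element of `Â_h`. -/
def ofFun (hb : ℂ) : CTR →ₐ[ℂ] Ahat hb := (proj hb).comp Algebra.TensorProduct.includeRight

/-- The generators `x_1 = x`, `x_2 = y`, `x_3 = z` of `Â_h` (indexed by `0, 1, 2`). -/
def xGen (hb : ℂ) (k : Fin 3) : Ahat hb := ofU hb (UniversalEnvelopingAlgebra.ι ℂ (su2Gen hb k))

/-! ### Quantum partial derivatives -/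

/-- The shape of the matrix through which the quantum partial derivatives act. -/
def quatMat {R : Type*} [Ring R] (a : R) (v : Fin 3 → R) : Matrix (Fin 4) (Fin 4) R :=
  !![a, v 0, v 1, v 2;
    -v 0, a, -v 2, v 1;
    -v 1, v 2, a, -v 0;
    -v 2, -v 1, v 0, a]

/-- The characterization of the multiplicative map `a ↦ Θ(a)`, where
`Θ(a) = iħ (∂̂_t a, ∂_x a, ∂_y a, ∂_z a)` in the shape `quatMat` and `∂̂_t = ∂_t + (2/h) id`.
Multiplicativity is the quantum Leibniz rule. The values on generators express
`∂_j x_k = δ_jk`, `∂_t x_k = 0`, `∂_t t = 1` (so `∂_t τ = -i`), `∂_j t = 0`, and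
`∂_t ρ = -iħ/ρ`, `∂_k ρ = x_k/ρ`. -/
structure IsQPDMatrix (hb : ℂ) (Θ : Ahat hb →ₐ[ℂ] Matrix (Fin 4) (Fin 4) (Ahat hb)) : Prop where
  gen : ∀ k, Θ (xGen hb k)
    = quatMat (xGen hb k) (Pi.single k (algebraMap ℂ (Ahat hb) (Complex.I * hb)))
  tau : Θ (ofFun hb tauV) = quatMat (ofFun hb (tauV + algebraMap ℂ CTR hb)) 0
  rho : Θ (ofFun hb rhoV)
    = quatMat (ofFun hb ((rhoV ^ 2 + algebraMap ℂ CTR (hb ^ 2)) / rhoV))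
        (fun k => xGen hb k * ofFun hb (algebraMap ℂ CTR (Complex.I * hb) / rhoV))

theorem quatMat_mul {R : Type*} [Ring R] (a b : R) (v w : Fin 3 → R) :
    quatMat a v * quatMat b w = quatMat (a * b - v 0 * w 0 - v 1 * w 1 - v 2 * w 2)
      ![a * w 0 + v 0 * b + v 1 * w 2 - v 2 * w 1,
        a * w 1 + v 1 * b + v 2 * w 0 - v 0 * w 2,
        a * w 2 + v 2 * b + v 0 * w 1 - v 1 * w 0] := by
  ext i j
  fin_cases i <;> fin_cases j <;>
    simp [quatMat, Matrix.mul_apply, Fin.sum_univ_four] <;> abel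

theorem quatMat_add {R : Type*} [Ring R] (a b : R) (v w : Fin 3 → R) :
    quatMat a v + quatMat b w = quatMat (a + b) (v + w) := by
  ext i j
  fin_cases i <;> fin_cases j <;> simp [quatMat] <;> abel

theorem quatMat_sub {R : Type*} [Ring R] (a b : R) (v w : Fin 3 → R) :
    quatMat a v - quatMat b w = quatMat (a - b) (v - w) := by
  ext i j
  fin_cases i <;> fin_cases j <;> simp [quatMat] <;> abel

theorem quatMat_smul {R : Type*} [Ring R] [Algebra ℂ R] (c : ℂ) (a : R) (v : Fin 3 → R) :
    c • quatMat a v = quatMat (c • a) (c • v) := by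
  ext i j
  fin_cases i <;> fin_cases j <;> simp [quatMat]

theorem quatMat_algebraMap {R : Type*} [Ring R] [Algebra ℂ R] (c : ℂ) :
    algebraMap ℂ (Matrix (Fin 4) (Fin 4) R) c = quatMat (algebraMap ℂ R c) 0 := by
  ext i j
  fin_cases i <;> fin_cases j <;> simp [quatMat, Matrix.algebraMap_matrix_apply]

theorem proj_surjective (hb : ℂ) : Function.Surjective (proj hb) :=
  RingQuot.mkAlgHom_surjective ℂ _

theorem proj_tmul (hb : ℂ) (u : USu2 hb) (f : CTR) :
    proj hb (u ⊗ₜ f) = ofU hb u * ofFun hb f := by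
  simp [ofU, ofFun, ← map_mul]

theorem ofFun_commute (hb : ℂ) (f : CTR) (a : Ahat hb) : Commute (ofFun hb f) a := by
  obtain ⟨s, rfl⟩ := proj_surjective hb a
  induction s with
  | zero => simp
  | add s t hs ht => rw [map_add]; exact hs.add_right ht
  | tmul u g =>
    have h : Commute ((1 : USu2 hb) ⊗ₜ[ℂ] f) (u ⊗ₜ[ℂ] g) := by
      simp [commute_iff_eq, Algebra.TensorProduct.tmul_mul_tmul, mul_comm]
    exact h.map (proj hb)

/-- The linear map `su(2)_h → Â_h`. -/
def lin (hb : ℂ) : Su2 hb →ₗ[ℂ] Ahat hb :=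
  (ofU hb).toLinearMap.comp
    (UniversalEnvelopingAlgebra.ι ℂ : Su2 hb →ₗ⁅ℂ⁆ USu2 hb).toLinearMap

theorem lin_lie (hb : ℂ) (v w : Su2 hb) :
    lin hb ⁅v, w⁆ = lin hb v * lin hb w - lin hb w * lin hb v := by
  simp [lin, LieRing.of_associative_ring_bracket]

theorem lin_su2Gen (hb : ℂ) (k : Fin 3) : lin hb (su2Gen hb k) = xGen hb k := rfl

theorem lie_su2Gen (hb : ℂ) :
    ⁅su2Gen hb 0, su2Gen hb 1⁆ = (2 * Complex.I * hb) • su2Gen hb 2 ∧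
    ⁅su2Gen hb 1, su2Gen hb 2⁆ = (2 * Complex.I * hb) • su2Gen hb 0 ∧
    ⁅su2Gen hb 2, su2Gen hb 0⁆ = (2 * Complex.I * hb) • su2Gen hb 1 := by
  have key : ∀ i j k : Fin 3,
      crossProduct (Pi.single i 1 : Fin 3 → ℂ) (Pi.single j 1) = Pi.single k 1 →
      ⁅su2Gen hb i, su2Gen hb j⁆ = (2 * Complex.I * hb) • su2Gen hb k := by
    intro i j k h
    change su2Bracket hb (Pi.single i 1) (Pi.single j 1) = _
    rw [su2Bracket, h]
    rfl
  refine ⟨key 0 1 2 ?_, key 1 2 0 ?_, key 2 0 1 ?_⟩ <;>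
  · ext l
    fin_cases l <;> simp [cross_apply]

theorem xGen_comm (hb : ℂ) :
    xGen hb 0 * xGen hb 1 - xGen hb 1 * xGen hb 0 = (2 * Complex.I * hb) • xGen hb 2 ∧
    xGen hb 1 * xGen hb 2 - xGen hb 2 * xGen hb 1 = (2 * Complex.I * hb) • xGen hb 0 ∧
    xGen hb 2 * xGen hb 0 - xGen hb 0 * xGen hb 2 = (2 * Complex.I * hb) • xGen hb 1 := by
  simp only [← lin_su2Gen, ← lin_lie, ← map_smul]
  obtain ⟨h1, h2, h3⟩ := lie_su2Gen hb
  rw [h1, h2, h3]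
  exact ⟨rfl, rfl, rfl⟩

theorem radius (hb : ℂ) :
    xGen hb 0 * xGen hb 0 + xGen hb 1 * xGen hb 1 + xGen hb 2 * xGen hb 2
      = ofFun hb (rhoV ^ 2 - algebraMap ℂ CTR (hb ^ 2)) := by
  have h := RingQuot.mkAlgHom_rel ℂ (RadiusRel.radius (hb := hb))
  change proj hb _ = proj hb _ at h
  rw [map_add, proj_tmul, show proj hb (1 ⊗ₜ[ℂ] (rhoV ^ 2)) = ofFun hb (rhoV ^ 2) from rfl, map_one,
    mul_one, AlgHom.commutes] at h
  have h2 : ofU hb (casimir hb)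
      = xGen hb 0 * xGen hb 0 + xGen hb 1 * xGen hb 1 + xGen hb 2 * xGen hb 2 := by
    simp [casimir, Fin.sum_univ_three, xGen, pow_two]
  rw [map_sub, AlgHom.commutes, ← h, h2, add_sub_cancel_right]

theorem shift_tauV (a b : ℂ) : shift a b tauV = tauV + algebraMap ℂ CTR a := by
  simp only [shift, tauV, IsFractionRing.liftAlgHom_apply, IsFractionRing.lift_algebraMap]
  simp [polyShift, IsScalarTower.algebraMap_apply ℂ (MvPolynomial (Fin 2) ℂ) CTR,
    MvPolynomial.algebraMap_eq]

theorem shift_rhoV (a b : ℂ) : shift a b rhoV = rhoV + algebraMap ℂ CTR b := by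
  simp only [shift, rhoV, IsFractionRing.liftAlgHom_apply, IsFractionRing.lift_algebraMap]
  simp [polyShift, IsScalarTower.algebraMap_apply ℂ (MvPolynomial (Fin 2) ℂ) CTR,
    MvPolynomial.algebraMap_eq]

theorem rhoV_ne_zero : rhoV ≠ 0 := by
  rw [rhoV, Ne, map_eq_zero_iff _ (IsFractionRing.injective (MvPolynomial (Fin 2) ℂ) CTR)]
  exact MvPolynomial.X_ne_zero 1

/-- The value of the multiplicative map on `f(τ, ρ)`. -/
def funQuat (hb : ℂ) (f : CTR) : Matrix (Fin 4) (Fin 4) (Ahat hb) :=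
  quatMat (ofFun hb ((shift hb hb f * (rhoV + algebraMap ℂ CTR hb)
      + shift hb (-hb) f * (rhoV - algebraMap ℂ CTR hb)) / (2 * rhoV)))
    (fun k => xGen hb k * ofFun hb (algebraMap ℂ CTR Complex.I
      * (shift hb hb f - shift hb (-hb) f) / (2 * rhoV)))

theorem funQuat_mul (hb : ℂ) (f g : CTR) : funQuat hb (f * g) = funQuat hb f * funQuat hb g := by
  have hr := rhoV_ne_zero
  have hI : algebraMap ℂ CTR Complex.I ^ 2 = -1 := by
    rw [← map_pow, Complex.I_sq, map_neg, map_one]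
  obtain ⟨c1, c2, c3⟩ := xGen_comm hb
  have hrad := radius hb
  simp only [funQuat, quatMat_mul, map_mul (shift hb hb), map_mul (shift hb (-hb))]
  set p := shift hb hb f
  set q := shift hb (-hb) f
  set p' := shift hb hb g
  set q' := shift hb (-hb) g
  set A := (p * (rhoV + algebraMap ℂ CTR hb) + q * (rhoV - algebraMap ℂ CTR hb)) / (2 * rhoV)
    with hA
  set B := algebraMap ℂ CTR Complex.I * (p - q) / (2 * rhoV) with hB
  set A' := (p' * (rhoV + algebraMap ℂ CTR hb) + q' * (rhoV - algebraMap ℂ CTR hb)) / (2 * rhoV)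
    with hA'
  set B' := algebraMap ℂ CTR Complex.I * (p' - q') / (2 * rhoV) with hB'
  have e1 : (p * p' * (rhoV + algebraMap ℂ CTR hb) + q * q' * (rhoV - algebraMap ℂ CTR hb))
      / (2 * rhoV) = A * A' - (rhoV ^ 2 - algebraMap ℂ CTR (hb ^ 2)) * (B * B') := by
    rw [hA, hB, hA', hB']
    field_simp
    simp only [map_pow]
    ring_nf
    rw [hI]
    ring
  have e2 : algebraMap ℂ CTR Complex.I * (p * p' - q * q') / (2 * rhoV)
      = A * B' + B * A' + algebraMap ℂ CTR (2 * Complex.I * hb) * (B * B') := by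
    rw [hA, hB, hA', hB']
    field_simp
    simp only [map_mul, map_ofNat]
    ring_nf
    rw [hI]
    ring
  have k1 : ∀ i j, xGen hb i * ofFun hb B * (xGen hb j * ofFun hb B')
      = xGen hb i * xGen hb j * ofFun hb (B * B') := by
    intro i j
    rw [mul_assoc, ← mul_assoc (ofFun hb B), (ofFun_commute hb B _).eq, map_mul, mul_assoc, mul_assoc]
  have k2 : ∀ i, ofFun hb A * (xGen hb i * ofFun hb B') = xGen hb i * ofFun hb (A * B') := by
    intro i
    rw [← mul_assoc, (ofFun_commute hb A _).eq, map_mul, mul_assoc]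
  have k3 : ∀ i, xGen hb i * ofFun hb B * ofFun hb A' = xGen hb i * ofFun hb (B * A') := by
    intro i
    rw [map_mul, mul_assoc]
  have k4 : ∀ x : Ahat hb, x * ofFun hb (algebraMap ℂ CTR (2 * Complex.I * hb) * (B * B'))
      = ((2 * Complex.I * hb) • x) * ofFun hb (B * B') := by
    intro x
    rw [map_mul, AlgHom.commutes, ← Algebra.smul_def, mul_smul_comm, smul_mul_assoc]
  rw [e1, e2]
  congr 1
  · rw [k1, k1, k1, map_sub, map_mul (ofFun hb) (rhoV ^ 2 - _), ← hrad, map_mul]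
    noncomm_ring
  · funext i
    fin_cases i <;> simp only [Fin.zero_eta, Fin.mk_one, Fin.reduceFinMk, Matrix.cons_val]
    · rw [k1, k1, k2, k3, map_add, map_add, mul_add, mul_add, k4, ← c2]
      noncomm_ring
    · rw [k1, k1, k2, k3, map_add, map_add, mul_add, mul_add, k4, ← c3]
      noncomm_ring
    · rw [k1, k1, k2, k3, map_add, map_add, mul_add, mul_add, k4, ← c1]
      noncomm_ring

theorem funQuat_algebraMap (hb : ℂ) (c : ℂ) : funQuat hb (algebraMap ℂ CTR c)
    = algebraMap ℂ (Matrix (Fin 4) (Fin 4) (Ahat hb)) c := by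
  have hr := rhoV_ne_zero
  rw [quatMat_algebraMap, ← AlgHom.commutes (ofFun hb)]
  simp only [funQuat, (shift hb hb).commutes, (shift hb (-hb)).commutes]
  congr 1
  · congr 1
    rw [div_eq_iff (mul_ne_zero two_ne_zero hr)]
    ring
  · funext k
    simp

/-- The action on functions of `τ, ρ`, as an algebra homomorphism. -/
def funHom (hb : ℂ) : CTR →ₐ[ℂ] Matrix (Fin 4) (Fin 4) (Ahat hb) where
  toFun := funQuat hb
  map_one' := by simpa using funQuat_algebraMap hb 1
  map_zero' := by simpa using funQuat_algebraMap hb 0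
  map_mul' := funQuat_mul hb
  map_add' f g := by
    simp only [funQuat, quatMat_add, ← map_add]
    congr 1
    · congr 1
      simp only [map_add]
      ring
    · funext k
      simp only [Pi.add_apply, ← mul_add, ← map_add]
      congr 2
      simp only [map_add]
      ring
  commutes' := funQuat_algebraMap hb

/-- The action on `su(2)_h`. -/
def su2Quat (hb : ℂ) (v : Fin 3 → ℂ) : Matrix (Fin 4) (Fin 4) (Ahat hb) :=
  quatMat (lin hb v) (fun k => algebraMap ℂ (Ahat hb) (Complex.I * hb * v k))

theorem scalar_aux {R : Type*} [Ring R] [Algebra ℂ R] (a b : R) (c d p q r s : ℂ) :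
    a * algebraMap ℂ R c + algebraMap ℂ R d * b + algebraMap ℂ R p * algebraMap ℂ R q
      - algebraMap ℂ R r * algebraMap ℂ R s
      - (b * algebraMap ℂ R d + algebraMap ℂ R c * a + algebraMap ℂ R s * algebraMap ℂ R r
        - algebraMap ℂ R q * algebraMap ℂ R p) = algebraMap ℂ R (2 * (p * q - r * s)) := by
  rw [Algebra.commutes c a, Algebra.commutes d b, Algebra.commutes s (algebraMap ℂ R r),
    Algebra.commutes q (algebraMap ℂ R p), map_mul, map_sub, map_mul, map_mul, map_ofNat]
  noncomm_ring

theorem su2Quat_lie (hb : ℂ) (v w : Fin 3 → ℂ) : su2Quat hb (su2Bracket hb v w)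
    = su2Quat hb v * su2Quat hb w - su2Quat hb w * su2Quat hb v := by
  have hl : lin hb (su2Bracket hb v w) = lin hb v * lin hb w - lin hb w * lin hb v :=
    lin_lie hb v w
  have hI := Complex.I_sq
  simp only [su2Quat, quatMat_mul, quatMat_sub]
  congr 1
  · rw [hl]
    simp only [← map_mul]
    have e : ∀ k, Complex.I * hb * v k * (Complex.I * hb * w k)
      = Complex.I * hb * w k * (Complex.I * hb * v k) := fun k => by ring
    rw [e, e, e]
    abel
  · funext k
    fin_cases k <;>
    · simp only [Fin.zero_eta, Fin.mk_one, Fin.reduceFinMk, Matrix.cons_val, Pi.sub_apply]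
      rw [scalar_aux]
      congr 1
      simp [su2Bracket, cross_apply]
      ring

/-- The action on `su(2)_h`, as a homomorphism of Lie algebras. -/
def su2Hom (hb : ℂ) : Su2 hb →ₗ⁅ℂ⁆ Matrix (Fin 4) (Fin 4) (Ahat hb) where
  toFun := su2Quat hb
  map_add' v w := by
    simp only [su2Quat, quatMat_add]
    congr 1
    · exact map_add (lin hb) v w
    · funext k
      rw [Pi.add_apply, ← map_add, ← mul_add]
      rfl
  map_smul' c v := by
    simp only [su2Quat, quatMat_smul, RingHom.id_apply]
    congr 1
    · exact map_smul (lin hb) c v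
    · funext k
      rw [Pi.smul_apply, Algebra.smul_def, ← map_mul, mul_left_comm]
      rfl
  map_lie' {v w} := su2Quat_lie hb v w

theorem funQuat_commute_su2Quat (hb : ℂ) (f : CTR) (v : Fin 3 → ℂ) :
    Commute (su2Quat hb v) (funQuat hb f) := by
  have key : ∀ k, su2Quat hb (Pi.single k 1)
      = quatMat (xGen hb k) (Pi.single k (algebraMap ℂ (Ahat hb) (Complex.I * hb))) := by
    intro k
    rw [su2Quat, ← lin_su2Gen]
    congr 1
    funext j
    by_cases h : j = k
    · subst h; simp
    · simp [h]
  have hs : ∀ k, Commute (su2Quat hb (Pi.single k 1)) (funQuat hb f) := by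
    intro k
    rw [key, funQuat]
    generalize (shift hb hb f * (rhoV + algebraMap ℂ CTR hb)
      + shift hb (-hb) f * (rhoV - algebraMap ℂ CTR hb)) / (2 * rhoV) = α
    generalize algebraMap ℂ CTR Complex.I * (shift hb hb f - shift hb (-hb) f) / (2 * rhoV) = β
    obtain ⟨c1, c2, c3⟩ := xGen_comm hb
    rw [commute_iff_eq, ← sub_eq_zero]
    have hα := fun x => (ofFun_commute hb α x).eq
    have hβ := fun x => (ofFun_commute hb β x).eq
    have hC := fun x => Algebra.commutes (Complex.I * hb) (x : Ahat hb)
    have hC2 : ∀ x : Ahat hb, (2 * Complex.I * hb) • x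
        = 2 * (algebraMap ℂ (Ahat hb) (Complex.I * hb) * x) := by
      intro x
      rw [← Algebra.smul_def, mul_assoc, mul_smul, ofNat_smul_eq_nsmul, nsmul_eq_mul]
      norm_num
    rw [hC2, sub_eq_iff_eq_add] at c1 c2 c3
    generalize algebraMap ℂ (Ahat hb) (Complex.I * hb) = C at *
    generalize ofFun hb α = a at *
    generalize ofFun hb β = b at *
    have hb' : ∀ i j, xGen hb i * b * xGen hb j = xGen hb i * xGen hb j * b := by
      intro i j
      rw [mul_assoc, hβ, mul_assoc]
    have hCb : ∀ i, C * (xGen hb i * b) = C * xGen hb i * b := fun i => (mul_assoc _ _ _).symm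
    have hbC : ∀ i, xGen hb i * b * C = C * xGen hb i * b := fun i => by rw [← hC, mul_assoc]
    simp only [quatMat_mul, quatMat_sub]
    have hz : quatMat (0 : Ahat hb) 0 = 0 := by
      ext i j
      fin_cases i <;> fin_cases j <;> simp [quatMat]
    rw [← hz]
    congr 1
    · fin_cases k <;> simp [hα, hCb, hbC]
    · funext j
      fin_cases k <;> fin_cases j <;> simp [hb', hCb, hbC, ← hC a, ← mul_assoc]
      all_goals try simp only [c1, c2, c3]
      all_goals noncomm_ring
  have hv : su2Quat hb v = ∑ k, v k • su2Quat hb (Pi.single k 1) := by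
    have h := map_sum (su2Hom hb) (fun k => (v k • su2Gen hb k)) Finset.univ
    simp only [map_smul] at h
    refine Eq.trans ?_ h
    congr 1
    exact pi_eq_sum_univ' v
  rw [hv]
  exact Commute.sum_left _ _ _ fun k _ => (hs k).smul_left _

theorem su2Hom_xGen (hb : ℂ) (k : Fin 3) : su2Hom hb (su2Gen hb k)
    = quatMat (xGen hb k) (Pi.single k (algebraMap ℂ (Ahat hb) (Complex.I * hb))) := by
  change su2Quat hb (Pi.single k 1) = _
  rw [su2Quat, ← lin_su2Gen]
  congr 1
  funext j
  by_cases h : j = k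
  · subst h; simp
  · simp [h]

/-- The action on `U(su(2)_h)`. -/
def uHom (hb : ℂ) : USu2 hb →ₐ[ℂ] Matrix (Fin 4) (Fin 4) (Ahat hb) :=
  UniversalEnvelopingAlgebra.lift ℂ (su2Hom hb)

theorem uHom_commute (hb : ℂ) (u : USu2 hb) (f : CTR) : Commute (uHom hb u) (funHom hb f) := by
  let S : Subalgebra ℂ (Matrix (Fin 4) (Fin 4) (Ahat hb)) :=
    Subalgebra.centralizer ℂ {funHom hb f}
  have hS : ∀ v, su2Hom hb v ∈ S := by
    intro v
    rw [Subalgebra.mem_centralizer_iff]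
    intro g hg
    rw [Set.mem_singleton_iff.1 hg]
    exact (funQuat_commute_su2Quat hb f v).eq.symm
  let φ : Su2 hb →ₗ⁅ℂ⁆ S :=
    { toFun := fun v => ⟨su2Hom hb v, hS v⟩
      map_add' := fun v w => Subtype.ext (map_add (su2Hom hb) v w)
      map_smul' := fun c v => Subtype.ext (map_smul (su2Hom hb) c v)
      map_lie' := fun {v w} => Subtype.ext (LieHom.map_lie (su2Hom hb) v w) }
  have h : S.val.comp (UniversalEnvelopingAlgebra.lift ℂ φ) = uHom hb := by
    apply UniversalEnvelopingAlgebra.hom_ext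
    ext v : 1
    simp [uHom, φ]
  rw [← h]
  have := (UniversalEnvelopingAlgebra.lift ℂ φ u).2
  rw [Subalgebra.mem_centralizer_iff] at this
  exact (this _ rfl).symm

/-- The action on `U(su(2)_h) ⊗ ℂ(τ, ρ)`. -/
def tensorHom (hb : ℂ) : USu2 hb ⊗[ℂ] CTR →ₐ[ℂ] Matrix (Fin 4) (Fin 4) (Ahat hb) :=
  Algebra.TensorProduct.lift (uHom hb) (funHom hb) (uHom_commute hb)

theorem funQuat_rhoV (hb : ℂ) : funQuat hb rhoV
    = quatMat (ofFun hb ((rhoV ^ 2 + algebraMap ℂ CTR (hb ^ 2)) / rhoV))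
        (fun k => xGen hb k * ofFun hb (algebraMap ℂ CTR (Complex.I * hb) / rhoV)) := by
  have hr := rhoV_ne_zero
  simp only [funQuat, shift_rhoV, map_neg, map_pow, map_mul (algebraMap ℂ CTR)]
  congr 1
  · congr 1
    field_simp
    ring
  · funext k
    congr 2
    field_simp
    ring

theorem funQuat_tauV (hb : ℂ) : funQuat hb tauV
    = quatMat (ofFun hb (tauV + algebraMap ℂ CTR hb)) 0 := by
  have hr := rhoV_ne_zero
  simp only [funQuat, shift_tauV]
  congr 1
  · congr 1
    rw [div_eq_iff (mul_ne_zero two_ne_zero hr)]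
    ring
  · funext k
    simp

theorem tensorHom_rel (hb : ℂ) ⦃s t : USu2 hb ⊗[ℂ] CTR⦄ (h : RadiusRel hb s t) :
    tensorHom hb s = tensorHom hb t := by
  obtain ⟨⟩ := h
  have hr := rhoV_ne_zero
  have e : tensorHom hb (1 ⊗ₜ[ℂ] (rhoV ^ 2)) = funQuat hb (rhoV ^ 2) := by
    simp [tensorHom, funHom]
  have e2 : tensorHom hb (casimir hb ⊗ₜ[ℂ] 1) = ∑ k, su2Hom hb (su2Gen hb k) ^ 2 := by
    simp [tensorHom, casimir, uHom]
  obtain ⟨c1, c2, c3⟩ := xGen_comm hb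
  rw [map_add, e, e2, AlgHom.commutes, Fin.sum_univ_three]
  simp only [su2Hom_xGen, pow_two, quatMat_mul, quatMat_add, quatMat_algebraMap, funQuat,
    shift_rhoV, map_mul (shift hb hb), map_mul (shift hb (-hb))]
  have hI2 : algebraMap ℂ (Ahat hb) (Complex.I * hb) * algebraMap ℂ (Ahat hb) (Complex.I * hb)
      = - algebraMap ℂ (Ahat hb) (hb ^ 2) := by
    rw [← map_mul, ← map_neg]
    congr 1
    linear_combination hb ^ 2 * Complex.I_sq
  congr 1
  · have e3 : ((rhoV + algebraMap ℂ CTR hb) * (rhoV + algebraMap ℂ CTR hb)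
        * (rhoV + algebraMap ℂ CTR hb) + (rhoV + algebraMap ℂ CTR (-hb))
        * (rhoV + algebraMap ℂ CTR (-hb)) * (rhoV - algebraMap ℂ CTR hb)) / (2 * rhoV)
        = (rhoV ^ 2 - algebraMap ℂ CTR (hb ^ 2)) + 4 * algebraMap ℂ CTR (hb ^ 2) := by
      rw [div_eq_iff (mul_ne_zero two_ne_zero hr)]
      simp only [map_neg, map_pow]
      ring
    rw [e3, map_add, ← radius, map_mul (ofFun hb), map_ofNat, AlgHom.commutes]
    generalize algebraMap ℂ (Ahat hb) (Complex.I * hb) = C at *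
    rw [← pow_two hb]
    simp [hI2]
    noncomm_ring
  · have e4 : algebraMap ℂ CTR Complex.I * ((rhoV + algebraMap ℂ CTR hb) * (rhoV + algebraMap ℂ CTR hb)
        - (rhoV + algebraMap ℂ CTR (-hb)) * (rhoV + algebraMap ℂ CTR (-hb))) / (2 * rhoV)
        = 2 * algebraMap ℂ CTR (Complex.I * hb) := by
      rw [div_eq_iff (mul_ne_zero two_ne_zero hr)]
      simp only [map_neg, map_mul]
      ring
    simp only [e4, map_mul (ofFun hb), map_ofNat, AlgHom.commutes]
    have hC := fun x => Algebra.commutes (Complex.I * hb) (x : Ahat hb)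
    generalize algebraMap ℂ (Ahat hb) (Complex.I * hb) = C at *
    funext k
    fin_cases k <;> simp [hC] <;> noncomm_ring

theorem existsUnique_QPDMatrix (hb : ℂ) :
    ∃! Θ : Ahat hb →ₐ[ℂ] Matrix (Fin 4) (Fin 4) (Ahat hb), IsQPDMatrix hb Θ := by
  let Θ : Ahat hb →ₐ[ℂ] Matrix (Fin 4) (Fin 4) (Ahat hb) :=
    RingQuot.liftAlgHom ℂ ⟨tensorHom hb, tensorHom_rel hb⟩
  have hΘ : ∀ s, Θ (proj hb s) = tensorHom hb s :=
    RingQuot.liftAlgHom_mkAlgHom_apply ℂ (tensorHom hb) (tensorHom_rel hb)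
  have hU : ∀ u, Θ (ofU hb u) = uHom hb u := fun u => by
    simp [ofU, hΘ, tensorHom]
  have hF : ∀ f, Θ (ofFun hb f) = funQuat hb f := fun f => by
    simp [ofFun, hΘ, tensorHom, funHom]
  refine ⟨Θ, ⟨fun k => ?_, ?_, ?_⟩, fun Ψ hΨ => ?_⟩
  · rw [xGen, hU, uHom, UniversalEnvelopingAlgebra.lift_ι_apply, su2Hom_xGen]
    rfl
  · rw [hF, funQuat_tauV]
  · rw [hF, funQuat_rhoV]
  · have h1 : Ψ.comp (ofU hb) = Θ.comp (ofU hb) := by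
      apply UniversalEnvelopingAlgebra.hom_ext
      ext v : 1
      have hv : v = ∑ k, (v : Fin 3 → ℂ) k • su2Gen hb k := pi_eq_sum_univ' (v : Fin 3 → ℂ)
      have hk : ∀ k, Ψ (lin hb (su2Gen hb k)) = Θ (lin hb (su2Gen hb k)) := by
        intro k
        rw [lin_su2Gen, xGen, hU, uHom, UniversalEnvelopingAlgebra.lift_ι_apply, su2Hom_xGen]
        exact hΨ.gen k
      change Ψ (lin hb v) = Θ (lin hb v)
      rw [hv]
      simp only [map_sum, map_smul, hk]
    have h2 : ∀ f, Ψ (ofFun hb f) = Θ (ofFun hb f) := by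
      have hp : (Ψ.comp (ofFun hb)).comp (IsScalarTower.toAlgHom ℂ (MvPolynomial (Fin 2) ℂ) CTR)
          = (Θ.comp (ofFun hb)).comp (IsScalarTower.toAlgHom ℂ (MvPolynomial (Fin 2) ℂ) CTR) := by
        apply MvPolynomial.algHom_ext
        intro i
        fin_cases i
        · change Ψ (ofFun hb tauV) = Θ (ofFun hb tauV)
          rw [hΨ.tau, hF, funQuat_tauV]
        · change Ψ (ofFun hb rhoV) = Θ (ofFun hb rhoV)
          rw [hΨ.rho, hF, funQuat_rhoV]
      intro f
      obtain ⟨p, q, hq, rfl⟩ := IsFractionRing.div_surjective (A := MvPolynomial (Fin 2) ℂ) f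
      have hpq := DFunLike.congr_fun hp p
      have hqq := DFunLike.congr_fun hp q
      have hq0 : algebraMap (MvPolynomial (Fin 2) ℂ) CTR q ≠ 0 :=
        IsFractionRing.to_map_ne_zero_of_mem_nonZeroDivisors hq
      have hunit : IsUnit (Θ (ofFun hb (algebraMap (MvPolynomial (Fin 2) ℂ) CTR q))) :=
        ((IsUnit.mk0 _ hq0).map (ofFun hb)).map Θ
      apply hunit.mul_right_cancel
      rw [← map_mul, ← map_mul, div_mul_cancel₀ _ hq0]
      refine Eq.trans ?_ hpq
      refine Eq.trans ?_ (congrArg (fun x => Ψ (ofFun hb x)) (div_mul_cancel₀ (algebraMap (MvPolynomial (Fin 2) ℂ) CTR p) hq0))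
      rw [map_mul, map_mul]
      exact congrArg _ hqq.symm
    ext a : 1
    obtain ⟨s, rfl⟩ := proj_surjective hb a
    induction s with
    | zero => simp
    | add s t hs ht => rw [map_add, map_add, map_add, hs, ht]
    | tmul u f =>
      rw [proj_tmul, map_mul, map_mul, h2]
      exact congrArg (· * _) (DFunLike.congr_fun h1 u)

/-- The multiplicative map `Θ`. -/
def qpdMatrix (hb : ℂ) : Ahat hb →ₐ[ℂ] Matrix (Fin 4) (Fin 4) (Ahat hb) :=
  (existsUnique_QPDMatrix hb).choose

theorem qpdMatrix_spec (hb : ℂ) : IsQPDMatrix hb (qpdMatrix hb) :=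
  (existsUnique_QPDMatrix hb).choose_spec.1

/-- The quantum partial derivatives `∂_x, ∂_y, ∂_z`. -/
def pd (hb : ℂ) (k : Fin 3) (a : Ahat hb) : Ahat hb :=
  (Complex.I * hb)⁻¹ • qpdMatrix hb a 0 k.succ

/-- The quantum partial derivative `∂_t = ∂̂_t - (2/h) id`. -/
def pdT (hb : ℂ) (a : Ahat hb) : Ahat hb := (Complex.I * hb)⁻¹ • (qpdMatrix hb a 0 0 - a)

/-- The quantum partial derivative `∂_τ = i ∂_t` (where `τ = -i t`). -/
def pdTau (hb : ℂ) (a : Ahat hb) : Ahat hb := Complex.I • pdT hb a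

theorem qpdMatrix_conj (hb : ℂ) (R : Matrix (Fin 4) (Fin 4) (Ahat hb)) (hR : R * R = -1)
    (hc : ∀ a v, R * quatMat a v = quatMat a v * R) (a : Ahat hb) :
    R * qpdMatrix hb a = qpdMatrix hb a * R := by
  let Ψ : Ahat hb →ₐ[ℂ] Matrix (Fin 4) (Fin 4) (Ahat hb) :=
    AlgHom.ofLinearMap
      { toFun := fun a => -(R * qpdMatrix hb a * R)
        map_add' := fun a b => by rw [map_add]; noncomm_ring
        map_smul' := fun c a => by simp }
      (by simp [hR])
      (fun a b => by
        change -(R * qpdMatrix hb (a * b) * R)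
          = -(R * qpdMatrix hb a * R) * -(R * qpdMatrix hb b * R)
        have : -(R * qpdMatrix hb a * R) * -(R * qpdMatrix hb b * R)
          = R * qpdMatrix hb a * (R * R) * qpdMatrix hb b * R := by noncomm_ring
        rw [this, hR, map_mul]
        noncomm_ring)
  have hval : ∀ x b v, qpdMatrix hb x = quatMat b v → Ψ x = quatMat b v := by
    intro x b v h
    change -(R * qpdMatrix hb x * R) = _
    rw [h, hc, mul_assoc, hR]
    noncomm_ring
  have hs := qpdMatrix_spec hb
  have hΨ : IsQPDMatrix hb Ψ :=
    ⟨fun k => hval _ _ _ (hs.gen k), hval _ _ _ hs.tau, hval _ _ _ hs.rho⟩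
  have h := DFunLike.congr_fun ((existsUnique_QPDMatrix hb).unique hΨ hs) a
  change -(R * qpdMatrix hb a * R) = qpdMatrix hb a at h
  conv_rhs => rw [← h]
  rw [neg_mul, mul_assoc _ R R, hR]
  noncomm_ring

/-- The matrix `Θ(a)` consists of the quantum partial derivatives of `a`, arranged in the shape
`quatMat`; so it is legitimate to read them off from its first row. -/
theorem qpdMatrix_eq (hb : ℂ) (hhb : hb ≠ 0) (a : Ahat hb) : qpdMatrix hb a
    = quatMat ((Complex.I * hb) • pdT hb a + a) (fun k => (Complex.I * hb) • pd hb k a) := by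
  have h0 : Complex.I * hb ≠ 0 := mul_ne_zero Complex.I_ne_zero hhb
  have hx := qpdMatrix_conj hb !![0, 1, 0, 0; -1, 0, 0, 0; 0, 0, 0, 1; 0, 0, -1, 0]
    (by ext i j; fin_cases i <;> fin_cases j <;> simp [Matrix.mul_apply, Fin.sum_univ_four])
    (by intro a v; ext i j
        fin_cases i <;> fin_cases j <;> simp [quatMat, Matrix.mul_apply, Fin.sum_univ_four]) a
  have hy := qpdMatrix_conj hb !![0, 0, 1, 0; 0, 0, 0, -1; -1, 0, 0, 0; 0, 1, 0, 0]
    (by ext i j; fin_cases i <;> fin_cases j <;> simp [Matrix.mul_apply, Fin.sum_univ_four])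
    (by intro a v; ext i j
        fin_cases i <;> fin_cases j <;> simp [quatMat, Matrix.mul_apply, Fin.sum_univ_four]) a
  have hz := qpdMatrix_conj hb !![0, 0, 0, 1; 0, 0, 1, 0; 0, -1, 0, 0; -1, 0, 0, 0]
    (by ext i j; fin_cases i <;> fin_cases j <;> simp [Matrix.mul_apply, Fin.sum_univ_four])
    (by intro a v; ext i j
        fin_cases i <;> fin_cases j <;> simp [quatMat, Matrix.mul_apply, Fin.sum_univ_four]) a
  simp only [pdT, pd, smul_inv_smul₀ h0, sub_add_cancel]
  generalize qpdMatrix hb a = M at *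
  have hx' := fun j => congrFun (congrFun hx 0) j
  have hy' := fun j => congrFun (congrFun hy 0) j
  have hz' := fun j => congrFun (congrFun hz 0) j
  simp [Fin.forall_fin_succ, Matrix.mul_apply, Fin.sum_univ_four] at hx' hy' hz'
  ext i j
  fin_cases i <;> fin_cases j <;> simp [quatMat, hx', hy', hz']

/-! ### The Bogomol'nyi equation and the hedgehog ansatz -/

/-- The symmetrized product `(a b + b a) / 2`. -/
def symProd {hb : ℂ} (a b : Ahat hb) : Ahat hb := (1 / 2 : ℂ) • (a * b + b * a)

/-- The field strength
`F_μν^i = ∂_μ A_ν^i - ∂_ν A_μ^i + ∑_{k,l} c_{kl}^i (A_μ^k A_ν^l + A_ν^l A_μ^k) / 2`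
of the gauge field `A μ i = A_μ^i`, for structure constants `c k l i = c_{kl}^i`. -/
def fieldStrength (hb : ℂ) {ι : Type*} [Fintype ι] (c : ι → ι → ι → ℂ)
    (A : Fin 3 → ι → Ahat hb) (μ ν : Fin 3) (i : ι) : Ahat hb :=
  pd hb μ (A ν i) - pd hb ν (A μ i) + ∑ k, ∑ l, c k l i • symProd (A μ k) (A ν l)

/-- The covariant derivative
`∇_μ φ^i = ∂_μ φ^i + ∑_{k,l} c_{kl}^i (A_μ^k φ^l + φ^l A_μ^k) / 2`. -/
def covDeriv (hb : ℂ) {ι : Type*} [Fintype ι] (c : ι → ι → ι → ℂ)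
    (A : Fin 3 → ι → Ahat hb) (φ : ι → Ahat hb) (μ : Fin 3) (i : ι) : Ahat hb :=
  pd hb μ (φ i) + ∑ k, ∑ l, c k l i • symProd (A μ k) (φ l)

/-- The Levi-Civita symbol, with `ε_{012} = 1`. -/
def levi (i j k : Fin 3) : ℂ :=
  (((j : ℕ) : ℂ) - ((i : ℕ) : ℂ)) * (((k : ℕ) : ℂ) - ((j : ℕ) : ℂ))
    * (((k : ℕ) : ℂ) - ((i : ℕ) : ℂ)) / 2

/-- The component `F_μν^i = ∑_λ ε_μνλ ∇_λ φ^i` of the Bogomol'nyi equation, for `su(2)` with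
structure constants `ε`. -/
def BogomolnyiAt (hb : ℂ) (A : Fin 3 → Fin 3 → Ahat hb) (φ : Fin 3 → Ahat hb)
    (μ ν i : Fin 3) : Prop :=
  fieldStrength hb levi A μ ν i = ∑ κ, levi μ ν κ • covDeriv hb levi A φ κ i

/-- The Bogomol'nyi equation. -/
def Bogomolnyi (hb : ℂ) (A : Fin 3 → Fin 3 → Ahat hb) (φ : Fin 3 → Ahat hb) : Prop :=
  ∀ μ ν i, BogomolnyiAt hb A φ μ ν i

/-- The hedgehog gauge field `A_μ^i = ∑_j ε_{μij} x_j W`. -/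
def hedgehogA (hb : ℂ) (W : CTR) (μ i : Fin 3) : Ahat hb :=
  ∑ j, levi μ i j • (xGen hb j * ofFun hb W)

/-- The hedgehog scalar field `φ^i = x_i F`. -/
def hedgehogPhi (hb : ℂ) (F : CTR) (i : Fin 3) : Ahat hb := xGen hb i * ofFun hb F

/-- The constant `ħ` in `ℂ(τ, ρ)`. -/
def hbarV (hb : ℂ) : CTR := algebraMap ℂ CTR hb

/-- `-(1/ρ) ∂_ρ W + W² = (1/ρ) ∂_ρ F - F W`. -/
def RadialEq1 (hb : ℂ) (W F : CTR) : Prop :=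
  -(1 / rhoV) * radialDeriv hb W + W ^ 2 = 1 / rhoV * radialDeriv hb F - F * W

/-- `((ρ² - ħ²)/ρ) ∂_ρ W + 2 W + 2 ħ ∂_τ W = F + ħ ∂_τ F + (ρ² - ħ²) F W`. -/
def RadialEq2 (hb : ℂ) (W F : CTR) : Prop :=
  (rhoV ^ 2 - hbarV hb ^ 2) / rhoV * radialDeriv hb W + 2 * W + 2 * hbarV hb * tauDeriv hb W
    = F + hbarV hb * tauDeriv hb F + (rhoV ^ 2 - hbarV hb ^ 2) * F * W

end NCYM

end

open NCYM

/-!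
The matrices `quatMat` multiply like quaternions, so the Leibniz rule gives every derivative in
closed form. On `ℂ(τ, ρ)` the homomorphism `Θ` is determined by its values on `τ` and `ρ`, which
yields the difference operators `∂_ρ` and `∂_τ` (`qpdMatrix_ofFun_eq_quatMat`). For `x_j f` the
commutator `[x_j, x_k]` is absorbed by symmetrization, and
`∂_k (x_j f) = S_jk (1/ρ) ∂_ρ f + δ_jk (f + ħ ∂_τ f)`, where `S_jk` is the symmetrized product of
`x_j` and `x_k` (`pd_xGen_mul`).

The hedgehog is therefore governed by the symmetric matrix `S` alone, whose trace is `ρ² - ħ²`, and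
contractions of Levi-Civita symbols bring both sides of the Bogomol'nyi equation to the form
`∑_κ ε_μνκ (S_κi p + δ_κi q)` with `p, q ∈ ℂ(τ, ρ)` (`fieldStrength_hedgehog`,
`covDeriv_hedgehog`). The two radial equations say precisely that the coefficients `p` and `q` of the
two sides agree, so they imply the Bogomol'nyi equation.

Conversely, the component `(1, 2, 1)` reads `S_31 p = S_31 p'` and the component `(1, 2, 3)` reads
`S_33 p + q = S_33 p' + q'`. Nonzero functions of `τ` and `ρ` are units in `Â_h`, so it suffices that
`S_31 ≠ 0` and that `ℂ(τ, ρ)` embeds in `Â_h`. Both follow from `Â_h ≠ 0`, the first by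
differentiating `S_31` twice (`symProd_xGen_ne_zero`). That `Â_h ≠ 0` is shown by a representation
on sequences over `ℂ(τ, ρ)` in which the Casimir element acts as `ρ² - ħ²` (`Ahat_nontrivial`).
-/

noncomputable section

namespace NCYM

attribute [local instance 100] LieRing.ofAssociativeRing

/-! ### Derivatives of functions of `τ` and `ρ`, and of their multiples by generators -/

/-- `Θ` agrees with `funHom` on all of `ℂ(τ, ρ)`: a homomorphism out of a fraction field is
determined by its values on polynomials, hence on `τ` and `ρ`. -/
theorem qpdMatrix_ofFun (hb : ℂ) (f : CTR) : qpdMatrix hb (ofFun hb f) = funQuat hb f := by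
  have hs := qpdMatrix_spec hb
  have hp : (qpdMatrix hb).comp (ofFun hb) = funHom hb := by
    apply AlgHom.coe_ringHom_injective
    apply IsLocalization.ringHom_ext (nonZeroDivisors (MvPolynomial (Fin 2) ℂ))
    have : (((qpdMatrix hb).comp (ofFun hb)).comp
        (IsScalarTower.toAlgHom ℂ (MvPolynomial (Fin 2) ℂ) CTR))
        = (funHom hb).comp (IsScalarTower.toAlgHom ℂ (MvPolynomial (Fin 2) ℂ) CTR) := by
      apply MvPolynomial.algHom_ext
      intro i
      fin_cases i
      · exact hs.tau.trans (funQuat_tauV hb).symm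
      · exact hs.rho.trans (funQuat_rhoV hb).symm
    exact RingHom.ext fun p => DFunLike.congr_fun this p
  exact DFunLike.congr_fun hp f

/-- The matrix `Θ(f)` in terms of the two difference operators: since `iħ ∂_t = ħ ∂_τ`, its diagonal
entry `iħ ∂̂_t f` is `f + ħ ∂_τ f`. -/
theorem qpdMatrix_ofFun_eq_quatMat (hb : ℂ) (hhb : hb ≠ 0) (f : CTR) : qpdMatrix hb (ofFun hb f) =
    quatMat (ofFun hb (f + hbarV hb * tauDeriv hb f))
      (fun k => (Complex.I * hb) • (xGen hb k * ofFun hb (1 / rhoV * radialDeriv hb f))) := by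
  have hI : Complex.I * hb ≠ 0 := mul_ne_zero Complex.I_ne_zero hhb
  have hb' : algebraMap ℂ CTR hb ≠ 0 := by simpa using hhb
  have hr := rhoV_ne_zero
  rw [qpdMatrix_ofFun, funQuat]
  congr 1
  · congr 1
    rw [tauDeriv, hbarV]
    field_simp
    ring
  · funext k
    rw [← mul_smul_comm, ← map_smul, radialDeriv, Algebra.smul_def]
    congr 2
    simp only [map_mul, map_ofNat]
    field_simp

theorem pd_ofFun (hb : ℂ) (hhb : hb ≠ 0) (f : CTR) (k : Fin 3) :
    pd hb k (ofFun hb f) = xGen hb k * ofFun hb (1 / rhoV * radialDeriv hb f) := by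
  rw [pd, inv_smul_eq_iff₀ (mul_ne_zero Complex.I_ne_zero hhb), qpdMatrix_ofFun_eq_quatMat hb hhb]
  fin_cases k <;> rfl

theorem pdTau_ofFun (hb : ℂ) (hhb : hb ≠ 0) (f : CTR) :
    pdTau hb (ofFun hb f) = ofFun hb (tauDeriv hb f) := by
  have h : qpdMatrix hb (ofFun hb f) 0 0 = ofFun hb (f + hbarV hb * tauDeriv hb f) := by
    rw [qpdMatrix_ofFun_eq_quatMat hb hhb]
    rfl
  rw [pdTau, pdT, h, map_add, add_sub_cancel_left, map_mul, hbarV, AlgHom.commutes,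
    ← Algebra.smul_def, smul_smul, smul_smul,
    show Complex.I * (Complex.I * hb)⁻¹ * hb = 1 by field_simp, one_smul]

/-- The derivative `∂_k (x_j f)`. The cross product in the Leibniz rule contributes a commutator term
which turns the product `x_j x_k` into the symmetrized product. -/
theorem pd_xGen_mul (hb : ℂ) (hhb : hb ≠ 0) (f : CTR) (j k : Fin 3) :
    pd hb k (xGen hb j * ofFun hb f) =
      symProd (xGen hb j) (xGen hb k) * ofFun hb (1 / rhoV * radialDeriv hb f)
      + if j = k then ofFun hb (f + hbarV hb * tauDeriv hb f) else 0 := by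
  have hI : Complex.I * hb ≠ 0 := mul_ne_zero Complex.I_ne_zero hhb
  rw [pd, inv_smul_eq_iff₀ hI, map_mul, (qpdMatrix_spec hb).gen,
    qpdMatrix_ofFun_eq_quatMat hb hhb, quatMat_mul, Algebra.algebraMap_eq_smul_one]
  obtain ⟨c1, c2, c3⟩ := xGen_comm hb
  generalize 1 / rhoV * radialDeriv hb f = g
  generalize f + hbarV hb * tauDeriv hb f = g'
  rw [sub_eq_iff_eq_add, mul_assoc, mul_smul] at c1 c2 c3
  generalize Complex.I * hb = c at *
  have h2 : ∀ a : Ahat hb, (2 : ℂ) • a = a + a := two_smul ℂ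
  rw [h2] at c1 c2 c3
  fin_cases j <;> fin_cases k <;> simp [quatMat, symProd, smul_add, add_mul]
  all_goals
    simp only [← mul_assoc, c1, c2, c3, add_mul, smul_mul_assoc]
    module

/-! ### A representation of `Â_h` -/

/-- The weighted shift `(f n) ↦ (c n * f (n + m))` on sequences indexed by `ℤ`. -/
def ladderOp (c : ℤ → CTR) (m : ℤ) : Module.End CTR (ℤ → CTR) where
  toFun f n := c n * f (n + m)
  map_add' f g := by funext n; simp [mul_add]
  map_smul' a f := by funext n; simp; ring

theorem ladderOp_apply (c : ℤ → CTR) (m : ℤ) (f : ℤ → CTR) (n : ℤ) :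
    ladderOp c m f n = c n * f (n + m) := rfl

/-- The eigenvalue `2ħn` of the generator `z` on the `n`-th coordinate. -/
def ladderWeight (hb : ℂ) (n : ℤ) : CTR := 2 * (n : CTR) * hbarV hb

/-- The operators by which `x, y, z` act on sequences over `ℂ(τ, ρ)`. The generator `z` is diagonal
with spacing `2ħ`, `x - i y` is the shift `f ↦ f (n + 1)`, and `x + i y` is the opposite shift with
weight `ρ² - (z_n - ħ)²`, which is what the Casimir value `ρ² - ħ²` requires. -/
def su2Op (hb : ℂ) : Fin 3 → Module.End CTR (ℤ → CTR) :=
  ![ladderOp (fun n => 1 / 2 * (rhoV ^ 2 - (ladderWeight hb n - hbarV hb) ^ 2)) (-1)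
      + ladderOp (fun _ => 1 / 2) 1,
    ladderOp (fun n => algebraMap ℂ CTR (-Complex.I / 2)
          * (rhoV ^ 2 - (ladderWeight hb n - hbarV hb) ^ 2)) (-1)
      + ladderOp (fun _ => algebraMap ℂ CTR (Complex.I / 2)) 1,
    ladderOp (ladderWeight hb) 0]

theorem su2Op_comm (hb : ℂ) :
    su2Op hb 0 * su2Op hb 1 - su2Op hb 1 * su2Op hb 0 = (2 * Complex.I * hb) • su2Op hb 2 ∧
    su2Op hb 1 * su2Op hb 2 - su2Op hb 2 * su2Op hb 1 = (2 * Complex.I * hb) • su2Op hb 0 ∧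
    su2Op hb 2 * su2Op hb 0 - su2Op hb 0 * su2Op hb 2 = (2 * Complex.I * hb) • su2Op hb 1 := by
  have hI : algebraMap ℂ CTR Complex.I ^ 2 = -1 := by
    rw [← map_pow, Complex.I_sq, map_neg, map_one]
  refine ⟨?_, ?_, ?_⟩ <;> refine LinearMap.ext fun f => funext fun n => ?_ <;>
    simp [su2Op, ladderOp_apply, ladderWeight, hbarV, Algebra.smul_def (A := CTR), map_mul, map_ofNat,
      add_assoc, map_div₀]
  · ring
  · ring
  · linear_combination (algebraMap ℂ CTR hb *
      ((rhoV ^ 2 - (2 * n * algebraMap ℂ CTR hb - algebraMap ℂ CTR hb) ^ 2) * f (n + -1)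
        - f (n + 1))) * hI

theorem su2Op_casimir (hb : ℂ) :
    ∑ k, su2Op hb k ^ 2 = algebraMap CTR _ (rhoV ^ 2 - hbarV hb ^ 2) := by
  have hI : algebraMap ℂ CTR Complex.I ^ 2 = -1 := by
    rw [← map_pow, Complex.I_sq, map_neg, map_one]
  refine LinearMap.ext fun f => funext fun n => ?_
  simp only [Fin.sum_univ_three, pow_two (su2Op hb _)]
  simp only [su2Op, Matrix.cons_val, LinearMap.add_apply, Module.End.mul_apply, ladderOp_apply,
    Pi.add_apply, Module.algebraMap_end_apply, Pi.smul_apply, smul_eq_mul, ladderWeight, hbarV,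
    add_assoc, map_div₀, map_neg, map_ofNat]
  norm_num
  -- `q m` is the weight of `x + i y`; the coefficient is that of `i²` in the action of `y²`
  set q : ℤ → CTR := fun m =>
    rhoV ^ 2 - (2 * (m : CTR) * algebraMap ℂ CTR hb - algebraMap ℂ CTR hb) ^ 2 with hq
  linear_combination (norm := (simp only [hq]; push_cast; ring_nf))
    (1 / 4 * (q n * q (n - 1) * f (n - 2) - (q n + q (n + 1)) * f n + f (n + 2))) * hI

/-- The representation of `su(2)_h` on sequences over `ℂ(τ, ρ)` given by `su2Op`. -/
def su2Rep (hb : ℂ) : Su2 hb →ₗ⁅ℂ⁆ Module.End CTR (ℤ → CTR) where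
  toFun v := ∑ k, (v : Fin 3 → ℂ) k • su2Op hb k
  map_add' v w := by
    rw [← Finset.sum_add_distrib]
    exact Finset.sum_congr rfl fun k _ => add_smul _ _ _
  map_smul' c v := by
    rw [Finset.smul_sum]
    exact Finset.sum_congr rfl fun k _ => mul_smul _ _ _
  map_lie' {v w} := by
    obtain ⟨c1, c2, c3⟩ := su2Op_comm hb
    rw [sub_eq_iff_eq_add] at c1 c2 c3
    have key : ∀ v w : Fin 3 → ℂ, ∑ k, su2Bracket hb v w k • su2Op hb k
        = (∑ k, v k • su2Op hb k) * (∑ k, w k • su2Op hb k)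
          - (∑ k, w k • su2Op hb k) * (∑ k, v k • su2Op hb k) := by
      intro v w
      simp [su2Bracket, cross_apply, Fin.sum_univ_three, mul_add, add_mul, c1, c2, c3]
      module
    exact key v w

theorem su2Rep_su2Gen (hb : ℂ) (k : Fin 3) : su2Rep hb (su2Gen hb k) = su2Op hb k := by
  change ∑ j, (Pi.single k 1 : Fin 3 → ℂ) j • su2Op hb j = _
  simp [Pi.single_apply]

/-- The quotient `Â_h` does not collapse, because it acts on the nonzero space of sequences over
`ℂ(τ, ρ)`. -/
theorem Ahat_nontrivial (hb : ℂ) : Nontrivial (Ahat hb) := by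
  let Φ : USu2 hb ⊗[ℂ] CTR →ₐ[ℂ] Module.End CTR (ℤ → CTR) :=
    Algebra.TensorProduct.lift (UniversalEnvelopingAlgebra.lift ℂ (su2Rep hb))
      (IsScalarTower.toAlgHom ℂ CTR _) fun u f => Algebra.commute_algebraMap_right f _
  have hΦ : ∀ ⦃s t : USu2 hb ⊗[ℂ] CTR⦄, RadiusRel hb s t → Φ s = Φ t := by
    rintro _ _ ⟨⟩
    have h1 : Φ (casimir hb ⊗ₜ[ℂ] 1) = ∑ k, su2Op hb k ^ 2 := by
      refine (Algebra.TensorProduct.lift_tmul _ _ _ _ _).trans ?_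
      rw [map_one, mul_one, casimir, map_sum]
      simp only [map_pow, UniversalEnvelopingAlgebra.lift_ι_apply, su2Rep_su2Gen]
    have h2 : Φ (1 ⊗ₜ[ℂ] (rhoV ^ 2)) = algebraMap CTR _ (rhoV ^ 2) := by
      refine (Algebra.TensorProduct.lift_tmul _ _ _ _ _).trans ?_
      rw [map_one, one_mul]
      rfl
    rw [map_add, h1, h2, su2Op_casimir, AlgHom.commutes,
      IsScalarTower.algebraMap_apply ℂ CTR (Module.End CTR (ℤ → CTR)), ← map_add, hbarV, map_pow,
      sub_add_cancel]
  let Ψ : Ahat hb →ₐ[ℂ] Module.End CTR (ℤ → CTR) := RingQuot.liftAlgHom ℂ ⟨Φ, hΦ⟩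
  exact Ψ.toRingHom.domain_nontrivial

/-! ### Linear algebra of derivatives and symmetrized products -/

theorem symProd_comm {hb : ℂ} (a b : Ahat hb) : symProd a b = symProd b a := by
  rw [symProd, symProd, add_comm]

theorem fieldStrength_skew (hb : ℂ) {ι : Type*} [Fintype ι] (c : ι → ι → ι → ℂ)
    (hc : ∀ k l i, c k l i = -c l k i) (A : Fin 3 → ι → Ahat hb) (μ ν : Fin 3) (i : ι) :
    fieldStrength hb c A ν μ i = -fieldStrength hb c A μ ν i := by
  have h : ∑ k, ∑ l, c k l i • symProd (A ν k) (A μ l)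
      = -∑ k, ∑ l, c k l i • symProd (A μ k) (A ν l) := by
    rw [Finset.sum_comm]
    simp only [← Finset.sum_neg_distrib]
    refine Finset.sum_congr rfl fun k _ => Finset.sum_congr rfl fun l _ => ?_
    rw [hc l k, neg_smul, symProd_comm]
  rw [fieldStrength, fieldStrength, h]
  abel

theorem ofFun_eq_zero (hb : ℂ) {a : Ahat hb} {f : CTR} (h : a * ofFun hb f = 0) :
    a = 0 ∨ f = 0 := by
  by_cases hf : f = 0
  · exact Or.inr hf
  · left
    have : IsUnit (ofFun hb f) := (IsUnit.mk0 f hf).map (ofFun hb)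
    exact this.mul_left_eq_zero.1 h

theorem pd_smul (hb : ℂ) (k : Fin 3) (c : ℂ) (a : Ahat hb) : pd hb k (c • a) = c • pd hb k a := by
  rw [pd, pd, map_smul, Matrix.smul_apply, smul_comm]

theorem pd_zero (hb : ℂ) (k : Fin 3) : pd hb k 0 = 0 := by simp [pd]

theorem pd_sum (hb : ℂ) (k : Fin 3) {ι : Type*} (s : Finset ι) (a : ι → Ahat hb) :
    pd hb k (∑ j ∈ s, a j) = ∑ j ∈ s, pd hb k (a j) := by
  simp only [pd, map_sum, Matrix.sum_apply, Finset.smul_sum]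

theorem pd_xGen (hb : ℂ) (hhb : hb ≠ 0) (j k : Fin 3) :
    pd hb k (xGen hb j) = if j = k then 1 else 0 := by
  have hI : Complex.I * hb ≠ 0 := mul_ne_zero Complex.I_ne_zero hhb
  rw [pd, (qpdMatrix_spec hb).gen, inv_smul_eq_iff₀ hI, Algebra.algebraMap_eq_smul_one]
  fin_cases j <;> fin_cases k <;> simp [quatMat]

/-- The derivative `∂_x` of this element is `z`, and `∂_z z = 1 ≠ 0`. -/
theorem symProd_xGen_ne_zero (hb : ℂ) (hhb : hb ≠ 0) :
    symProd (xGen hb 2) (xGen hb 0) ≠ 0 := by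
  intro h
  have := Ahat_nontrivial hb
  have hI : Complex.I * hb ≠ 0 := mul_ne_zero Complex.I_ne_zero hhb
  have h2 : pd hb 0 (symProd (xGen hb 2) (xGen hb 0)) = xGen hb 2 := by
    rw [symProd, pd, map_smul, map_add, map_mul, map_mul, (qpdMatrix_spec hb).gen,
      (qpdMatrix_spec hb).gen, inv_smul_eq_iff₀ hI, Algebra.algebraMap_eq_smul_one]
    simp [quatMat, ← two_smul ℂ, smul_smul]
  rw [h, pd_zero] at h2
  have h1 := pd_xGen hb hhb 2 2
  rw [← h2, pd_zero] at h1
  simp at h1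

theorem symProd_mul_ofFun (hb : ℂ) (a b : Ahat hb) (f g : CTR) :
    symProd (a * ofFun hb f) (b * ofFun hb g) = symProd a b * ofFun hb (f * g) := by
  have h : ∀ (a b : Ahat hb) (f g : CTR), a * ofFun hb f * (b * ofFun hb g) =
      a * b * ofFun hb (f * g) := by
    intro a b f g
    rw [mul_assoc, ← mul_assoc (ofFun hb f), (ofFun_commute hb f b).eq, map_mul]
    simp only [mul_assoc]
  rw [symProd, symProd, h, h, smul_mul_assoc, add_mul, mul_comm g f]

/-- The radius relation, in terms of symmetrized products. -/
theorem sum_symProd (hb : ℂ) :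
    ∑ j, symProd (xGen hb j) (xGen hb j) = ofFun hb (rhoV ^ 2 - hbarV hb ^ 2) := by
  rw [hbarV, ← map_pow, ← radius, Fin.sum_univ_three]
  simp only [symProd]
  module

theorem symProd_sum_left {hb : ℂ} {ι : Type*} (s : Finset ι) (c : ι → ℂ) (a : ι → Ahat hb)
    (b : Ahat hb) : symProd (∑ j ∈ s, c j • a j) b = ∑ j ∈ s, c j • symProd (a j) b := by
  simp only [symProd, Finset.sum_mul, Finset.mul_sum, ← Finset.sum_add_distrib, Finset.smul_sum,
    smul_mul_assoc, mul_smul_comm, ← smul_add]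
  exact Finset.sum_congr rfl fun _ _ => smul_comm _ _ _

/-! ### Contractions with the Levi-Civita symbol -/

theorem levi_eq : levi = ![![![0, 0, 0], ![0, 0, 1], ![0, -1, 0]],
    ![![0, 0, -1], ![0, 0, 0], ![1, 0, 0]], ![![0, 1, 0], ![-1, 0, 0], ![0, 0, 0]]] := by
  funext i j k
  fin_cases i <;> fin_cases j <;> fin_cases k <;> simp [levi] <;> norm_num

section Levi

variable {M : Type*} [AddCommGroup M] [Module ℂ M] (S : Fin 3 → Fin 3 → M)

/-- The contraction occurring in the linear part of the field strength of the hedgehog, with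
`S j k` standing for the symmetrized product of `x_j` and `x_k`. -/
theorem levi_sum_trace (hS : ∀ i j, S i j = S j i) (μ ν i : Fin 3) :
    ∑ j, levi ν i j • S j μ - ∑ j, levi μ i j • S j ν
      = ∑ κ, levi μ ν κ • ((if κ = i then ∑ j, S j j else 0) - S κ i) := by
  have h10 := hS 1 0
  have h20 := hS 2 0
  have h21 := hS 2 1
  fin_cases μ <;> fin_cases ν <;> fin_cases i <;>
    simp [levi_eq, Fin.sum_univ_three, h10, h20, h21] <;> abel

/-- The contraction occurring in the quadratic part of the field strength of the hedgehog. -/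
theorem levi_sum_quad (hS : ∀ i j, S i j = S j i) (μ ν i : Fin 3) :
    ∑ k, ∑ l, levi k l i • ∑ a, ∑ b, (levi μ k a * levi ν l b) • S a b
      = ∑ κ, levi μ ν κ • S κ i := by
  have h10 := hS 1 0
  have h20 := hS 2 0
  have h21 := hS 2 1
  fin_cases μ <;> fin_cases ν <;> fin_cases i <;>
    simp [levi_eq, Fin.sum_univ_three, h10, h20, h21]

/-- The contraction occurring in the covariant derivative of the hedgehog. -/
theorem levi_sum_cov (μ i : Fin 3) :
    ∑ k, ∑ l, levi k l i • ∑ j, levi μ k j • S j l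
      = (if μ = i then ∑ j, S j j else 0) - S i μ := by
  fin_cases μ <;> fin_cases i <;>
    simp [levi_eq, Fin.sum_univ_three] <;> abel

end Levi

/-! ### The hedgehog -/

/-- The covariant derivative of the hedgehog consists of a multiple of the symmetrized product of
`x_μ` and `x_i` and a multiple of `δ_μi`; the coefficients are the right-hand sides of the two radial
equations. -/
theorem covDeriv_hedgehog (hb : ℂ) (hhb : hb ≠ 0) (W F : CTR) (μ i : Fin 3) :
    covDeriv hb levi (hedgehogA hb W) (hedgehogPhi hb F) μ i =
      symProd (xGen hb μ) (xGen hb i) * ofFun hb (1 / rhoV * radialDeriv hb F - F * W)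
      + if μ = i then ofFun hb (F + hbarV hb * tauDeriv hb F + (rhoV ^ 2 - hbarV hb ^ 2) * F * W)
        else 0 := by
  have h : ∀ k l, symProd (hedgehogA hb W μ k) (hedgehogPhi hb F l)
      = ∑ j, levi μ k j • (symProd (xGen hb j) (xGen hb l) * ofFun hb (F * W)) := by
    intro k l
    rw [hedgehogA, symProd_sum_left]
    simp only [hedgehogPhi, symProd_mul_ofFun, mul_comm W F]
  simp only [covDeriv, h]
  rw [levi_sum_cov fun j l => symProd (xGen hb j) (xGen hb l) * ofFun hb (F * W), ← Finset.sum_mul,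
    sum_symProd, ← map_mul, hedgehogPhi, pd_xGen_mul hb hhb, symProd_comm (xGen hb i), map_sub,
    mul_sub, mul_assoc _ F W, map_add _ (F + _)]
  by_cases hi : μ = i
  · simp only [hi, if_true]
    abel
  · simp only [hi, Ne.symm hi, if_false]
    abel

/-- The field strength of the hedgehog is dual to an expression of the same shape as the covariant
derivative; the coefficients are the left-hand sides of the two radial equations. -/
theorem fieldStrength_hedgehog (hb : ℂ) (hhb : hb ≠ 0) (W : CTR) (μ ν i : Fin 3) :
    fieldStrength hb levi (hedgehogA hb W) μ ν i = ∑ κ, levi μ ν κ •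
      (symProd (xGen hb κ) (xGen hb i) * ofFun hb (-(1 / rhoV) * radialDeriv hb W + W ^ 2)
      + if κ = i then ofFun hb ((rhoV ^ 2 - hbarV hb ^ 2) / rhoV * radialDeriv hb W + 2 * W
          + 2 * hbarV hb * tauDeriv hb W)
        else 0) := by
  have h : ∀ k l, symProd (hedgehogA hb W μ k) (hedgehogA hb W ν l)
      = ∑ a, ∑ b, (levi μ k a * levi ν l b) •
        (symProd (xGen hb a) (xGen hb b) * ofFun hb (W ^ 2)) := by
    intro k l
    rw [hedgehogA, symProd_sum_left]
    refine Finset.sum_congr rfl fun a _ => ?_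
    rw [symProd_comm, hedgehogA, symProd_sum_left, Finset.smul_sum]
    refine Finset.sum_congr rfl fun b _ => ?_
    rw [symProd_mul_ofFun, smul_smul, symProd_comm, pow_two]
  have hd : ∀ μ ν i, pd hb μ (hedgehogA hb W ν i) = ∑ j, levi ν i j •
        (symProd (xGen hb j) (xGen hb μ) * ofFun hb (1 / rhoV * radialDeriv hb W))
      + levi ν i μ • ofFun hb (W + hbarV hb * tauDeriv hb W) := by
    intro μ ν i
    rw [hedgehogA, pd_sum]
    simp only [pd_smul, pd_xGen_mul hb hhb, smul_add, Finset.sum_add_distrib, smul_ite, smul_zero,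
      Finset.sum_ite_eq', Finset.mem_univ, if_true]
  have e : (rhoV ^ 2 - hbarV hb ^ 2) / rhoV * radialDeriv hb W + 2 * W
      + 2 * hbarV hb * tauDeriv hb W = (rhoV ^ 2 - hbarV hb ^ 2) * (1 / rhoV * radialDeriv hb W)
      + (W + hbarV hb * tauDeriv hb W) + (W + hbarV hb * tauDeriv hb W) := by ring
  simp only [fieldStrength, h, hd, e, neg_mul]
  generalize 1 / rhoV * radialDeriv hb W = D
  generalize W + hbarV hb * tauDeriv hb W = T
  have hS : ∀ (f : CTR) (j k : Fin 3), symProd (xGen hb j) (xGen hb k) * ofFun hb f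
      = symProd (xGen hb k) (xGen hb j) * ofFun hb f := fun f j k => by rw [symProd_comm]
  rw [levi_sum_quad _ (hS _), add_sub_add_comm, levi_sum_trace _ (hS _), ← Finset.sum_mul,
    sum_symProd, ← map_mul]
  have hT : levi ν i μ • ofFun hb T - levi μ i ν • ofFun hb T
      = ∑ κ, levi μ ν κ • if κ = i then ofFun hb T + ofFun hb T else 0 := by
    have h1 : levi ν i μ = levi μ ν i := by simp only [levi]; ring
    have h2 : levi μ i ν = -levi μ ν i := by simp only [levi]; ring
    simp only [smul_ite, smul_zero, Finset.sum_ite_eq', Finset.mem_univ, if_true, h1, h2]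
    module
  rw [hT, ← Finset.sum_add_distrib, ← Finset.sum_add_distrib]
  refine Finset.sum_congr rfl fun κ _ => ?_
  rw [← smul_add, ← smul_add]
  congr 1
  simp only [map_add, map_neg, mul_add, mul_neg]
  split_ifs <;> abel

theorem bogomolnyiAt_hedgehog (hb : ℂ) (hhb : hb ≠ 0) (W F : CTR) (μ ν i : Fin 3) :
    BogomolnyiAt hb (hedgehogA hb W) (hedgehogPhi hb F) μ ν i ↔ ∑ κ, levi μ ν κ •
      (symProd (xGen hb κ) (xGen hb i) * ofFun hb (-(1 / rhoV) * radialDeriv hb W + W ^ 2)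
      + if κ = i then ofFun hb ((rhoV ^ 2 - hbarV hb ^ 2) / rhoV * radialDeriv hb W + 2 * W
          + 2 * hbarV hb * tauDeriv hb W)
        else 0) = ∑ κ, levi μ ν κ •
      (symProd (xGen hb κ) (xGen hb i) * ofFun hb (1 / rhoV * radialDeriv hb F - F * W)
      + if κ = i then ofFun hb (F + hbarV hb * tauDeriv hb F + (rhoV ^ 2 - hbarV hb ^ 2) * F * W)
        else 0) := by
  rw [BogomolnyiAt, fieldStrength_hedgehog hb hhb]
  simp only [covDeriv_hedgehog hb hhb]

theorem bogomolnyi_of_radialEq (hb : ℂ) (hhb : hb ≠ 0) {W F : CTR} (h1 : RadialEq1 hb W F)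
    (h2 : RadialEq2 hb W F) : Bogomolnyi hb (hedgehogA hb W) (hedgehogPhi hb F) := by
  intro μ ν i
  rw [bogomolnyiAt_hedgehog hb hhb, h1, h2]

/-- The off-diagonal component `(1, 2, 1)` contains only the first radial equation, multiplied by the
symmetrized product of `z` and `x`; in the diagonal component `(1, 2, 3)` the first equation then
cancels and the second one remains. -/
theorem radialEq_of_bogomolnyiAt (hb : ℂ) (hhb : hb ≠ 0) {W F : CTR}
    (h0 : BogomolnyiAt hb (hedgehogA hb W) (hedgehogPhi hb F) 0 1 0)
    (h2 : BogomolnyiAt hb (hedgehogA hb W) (hedgehogPhi hb F) 0 1 2) :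
    RadialEq1 hb W F ∧ RadialEq2 hb W F := by
  have := Ahat_nontrivial hb
  have hl : levi 0 1 0 = 0 ∧ levi 0 1 1 = 0 ∧ levi 0 1 2 = 1 := by simp [levi_eq]
  rw [bogomolnyiAt_hedgehog hb hhb] at h0 h2
  simp only [Fin.sum_univ_three, hl, zero_smul, zero_add, one_smul, Fin.reduceEq, if_false,
    add_zero, if_true] at h0 h2
  rw [← sub_eq_zero, ← mul_sub, ← map_sub] at h0
  have h1 : RadialEq1 hb W F :=
    sub_eq_zero.1 ((ofFun_eq_zero hb h0).resolve_left (symProd_xGen_ne_zero hb hhb))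
  rw [h1] at h2
  exact ⟨h1, (ofFun hb).toRingHom.injective (add_left_cancel h2)⟩

end NCYM

end

open NCYM
theorem mainTheorem1 (hb : ℂ) (hhb : hb ≠ 0) :
    -- the action of the quantum partial derivatives on functions of `τ` and `ρ`
    (∀ f : CTR, pdTau hb (ofFun hb f) = ofFun hb (tauDeriv hb f) ∧
      ∀ k, pd hb k (ofFun hb f) = xGen hb k * ofFun hb (1 / rhoV * radialDeriv hb f)) ∧
    -- skew-symmetry of the field strength with symmetrized products
    (∀ (n : ℕ) (c : Fin n → Fin n → Fin n → ℂ), (∀ k l i, c k l i = -c l k i) →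
      ∀ (A : Fin 3 → Fin n → Ahat hb) (μ ν : Fin 3) (i : Fin n),
        fieldStrength hb c A ν μ i = -fieldStrength hb c A μ ν i) ∧
    -- reduction of the Bogomol'nyi equation for the hedgehog to two scalar equations;
    -- two of its components already suffice
    ∀ W F : CTR,
      (Bogomolnyi hb (hedgehogA hb W) (hedgehogPhi hb F) ↔
        RadialEq1 hb W F ∧ RadialEq2 hb W F) ∧
      ((BogomolnyiAt hb (hedgehogA hb W) (hedgehogPhi hb F) 0 1 0 ∧
          BogomolnyiAt hb (hedgehogA hb W) (hedgehogPhi hb F) 0 1 2) ↔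
        RadialEq1 hb W F ∧ RadialEq2 hb W F) := by

  refine ⟨fun f => ⟨pdTau_ofFun hb hhb f, pd_ofFun hb hhb f⟩,
    fun n c hc A μ ν i => fieldStrength_skew hb c hc A μ ν i, fun W F => ⟨⟨fun h => ?_, fun h => ?_⟩,
      fun h => ?_, fun h => ?_⟩⟩
  · exact radialEq_of_bogomolnyiAt hb hhb (h 0 1 0) (h 0 1 2)
  · exact bogomolnyi_of_radialEq hb hhb h.1 h.2
  · exact radialEq_of_bogomolnyiAt hb hhb h.1 h.2
  · have hB := bogomolnyi_of_radialEq hb hhb h.1 h.2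
    exact ⟨hB 0 1 0, hB 0 1 2⟩
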